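/- Work over $\mathbb{C}$. Let $X\subset\mathbb{P}^N$ be an integral (reduced and irreducible) closed projective variety that is nondegenerate, i.e. not contained in a proper linear subspace. Let $X_{\mathrm{reg}}$ be its set of smooth points and, for $p\in X$, let $T_pX\subset\mathbb{P}^N$ be the embedded projective tangent space. Let $\mathcal{S}_r(X)$ be the set of all subsets of $X_{\mathrm{reg}}$ with exactly $r$ elements. For $A\in\mathcal{S}_r(X)$ let $\langle A\rangle$ be the linear span of $A$, let $\langle 2A\rangle$ be the linear span of $\bigcup_{p\in A}T_pX$, and let $$C(A)=\{x\in X_{\mathrm{reg}} : T_xX\subseteq\langle 2A\rangle\},\qquad E(A)=C(A)\setminus A$$ be the tangential contact locus of $A$ and its part outside $A$. Let $$\mathbb{T}_r(X)=\{A\in\mathcal{S}_r(X) : \langle 2A\rangle\neq\mathbb{P}^N\text{ and }\dim\langle 2A\rangle<r(\dim X+1)-1\}$$ be the $r$-th Terracini locus, and let $\sigma_r(X)\subseteq\mathbb{P}^N$ be the $r$-th secant variety, i.e. the Zariski closure of the union of the linear spans of $r$ points of $X$. Let $r$ be an integer with $r\le\frac{N+1}{\dim X+1}-1$. Let $A\in\mathcal{S}_r(X)$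 with $A\notin\mathbb{T}_r(X)$, and let $q\in\langle A\rangle$ with $q\notin\mathrm{Sing}(\sigma_r(X))$. Then every $B\in\mathcal{S}_r(X)$ with $B\neq A$ and $q\in\langle B\rangle$ satisfies $B\subseteq A\cup E(A)$. -/

import Mathlib

open scoped LinearAlgebra.Projectivization

namespace SecantContact

/-- Complex projective space `ℙ^N`, the lines through the origin of `ℂ^(N+1)`. -/
abbrev PN (N : ℕ) : Type := ℙ ℂ (Fin (N + 1) → ℂ)

/-- Homogeneous coordinate polynomials on `ℙ^N`. -/
abbrev Poly (N : ℕ) : Type := MvPolynomial (Fin (N + 1)) ℂ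

/-- Zariski closed subsets of `ℙ^N`: common zero loci of sets of homogeneous polynomials. -/
def IsZariskiClosed {N : ℕ} (X : Set (PN N)) : Prop :=
  ∃ S : Set (Poly N), (∀ f ∈ S, ∃ d : ℕ, f.IsHomogeneous d) ∧
    X = {p | ∀ f ∈ S, MvPolynomial.eval p.rep f = 0}

/-- The Zariski closure of a subset of `ℙ^N`. -/
def zariskiClosure {N : ℕ} (Y : Set (PN N)) : Set (PN N) :=
  ⋂₀ {Z | IsZariskiClosed Z ∧ Y ⊆ Z}

/-- The affine cone over `X` without its vertex. -/
def cone {N : ℕ} (X : Set (PN N)) : Set (Fin (N + 1) → ℂ) :=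
  {v | ∃ h : v ≠ 0, Projectivization.mk ℂ v h ∈ X}

/-- The homogeneous ideal `I(X)`: as `cone X` is stable under nonzero scalars, a polynomial
vanishes on it if and only if all its homogeneous components vanish on `X`. -/
noncomputable def homIdeal {N : ℕ} (X : Set (PN N)) : Ideal (Poly N) :=
  MvPolynomial.vanishingIdeal ℂ (cone X)

/-- An integral (reduced and irreducible) projective variety, given by its set of points:
a Zariski closed subset whose homogeneous ideal is prime (in particular it is nonempty). -/
structure IsIntegralVariety {N : ℕ} (X : Set (PN N)) : Prop where
  closed : IsZariskiClosed X
  prime : (homIdeal X).IsPrime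

/-- The linear span `⟨A⟩`. Linear subspaces of `ℙ^N` are represented throughout by the
corresponding vector subspaces of `ℂ^(N+1)`, whose dimension is larger by one. -/
noncomputable def linSpan {N : ℕ} (A : Set (PN N)) : Submodule ℂ (Fin (N + 1) → ℂ) :=
  ⨆ p ∈ A, p.submodule

/-- `X` is not contained in a proper linear subspace. -/
def IsNondegenerate {N : ℕ} (X : Set (PN N)) : Prop :=
  linSpan X = ⊤

/-- The dimension of a nonempty Zariski closed `X ⊆ ℙ^N`: one less than the Krull dimension of its
homogeneous coordinate ring, that is, than the dimension of its affine cone. For nonempty `X`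
that Krull dimension lies between `1` and `N + 1`, so that nothing is truncated here. -/
noncomputable def projDim {N : ℕ} (X : Set (PN N)) : ℕ :=
  ((ringKrullDim (Poly N ⧸ homIdeal X)).unbotD 0).toNat - 1

/-- The embedded projective (Zariski) tangent space `T_p X`: all `v` with
`∑ i, (∂f/∂x_i)(p) v_i = 0` for every `f` in the homogeneous ideal of `X`. -/
noncomputable def tangentSpace {N : ℕ} (X : Set (PN N)) (p : PN N) :
    Submodule ℂ (Fin (N + 1) → ℂ) where
  carrier := {v | ∀ f ∈ homIdeal X,
    ∑ i, MvPolynomial.eval p.rep (MvPolynomial.pderiv i f) * v i = 0}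
  add_mem' := by
    intro a b ha hb f hf
    simp only [Pi.add_apply, mul_add, Finset.sum_add_distrib, ha f hf, hb f hf, add_zero]
  zero_mem' := by
    intro f _
    simp
  smul_mem' := by
    intro c v hv f hf
    have h := hv f hf
    have h2 : ∑ i, MvPolynomial.eval p.rep (MvPolynomial.pderiv i f) * (c • v) i =
        c * ∑ i, MvPolynomial.eval p.rep (MvPolynomial.pderiv i f) * v i := by
      rw [Finset.mul_sum]
      refine Finset.sum_congr rfl fun i _ => ?_
      simp only [Pi.smul_apply, smul_eq_mul]
      ring
    rw [h2, h, mul_zero]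

/-- The set of smooth points of an irreducible variety `X` (Jacobian criterion): the points at
which the projective tangent space has dimension `dim X`. -/
def regLocus {N : ℕ} (X : Set (PN N)) : Set (PN N) :=
  {p | p ∈ X ∧ Module.finrank ℂ (tangentSpace X p) = projDim X + 1}

/-- The set of singular points of an irreducible variety `X`. -/
def singLocus {N : ℕ} (X : Set (PN N)) : Set (PN N) :=
  X \ regLocus X

/-- `𝒮_r(X)`: the sets of `r` distinct smooth points of `X`. -/
def smoothSets {N : ℕ} (X : Set (PN N)) (r : ℕ) : Set (Finset (PN N)) :=
  {A | A.card = r ∧ (A : Set (PN N)) ⊆ regLocus X}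

/-- `⟨2A⟩`: the span of the tangent spaces of `X` at the points of `A`. -/
noncomputable def doubleSpan {N : ℕ} (X : Set (PN N)) (A : Finset (PN N)) :
    Submodule ℂ (Fin (N + 1) → ℂ) :=
  ⨆ p ∈ A, tangentSpace X p

/-- The `r`-th Terracini locus `𝕋_r(X)`: those `A` with `⟨2A⟩ ≠ ℙ^N` and
`dim ⟨2A⟩ < r (dim X + 1) - 1` (both sides are increased by one below). -/
def terraciniLocus {N : ℕ} (X : Set (PN N)) (r : ℕ) : Set (Finset (PN N)) :=
  {A | A ∈ smoothSets X r ∧ doubleSpan X A ≠ ⊤ ∧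
    Module.finrank ℂ (doubleSpan X A) < r * (projDim X + 1)}

/-- The tangential contact locus `C(A)`: the smooth points `x` of `X` along which `⟨2A⟩` is
tangent to `X`, that is, `T_x X ⊆ ⟨2A⟩`. -/
def contactLocus {N : ℕ} (X : Set (PN N)) (A : Finset (PN N)) : Set (PN N) :=
  {x | x ∈ regLocus X ∧ tangentSpace X x ≤ doubleSpan X A}

/-- `E(A) = C(A) \ A`. -/
def extraContact {N : ℕ} (X : Set (PN N)) (A : Finset (PN N)) : Set (PN N) :=
  contactLocus X A \ (A : Set (PN N))

/-- The `r`-th secant variety `σ_r(X)`: the Zariski closure of the union of the linear spans of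
`r` points of `X`. -/
def secantVariety {N : ℕ} (X : Set (PN N)) (r : ℕ) : Set (PN N) :=
  zariskiClosure
    {q | ∃ x : Fin r → PN N, (∀ i, x i ∈ X) ∧ q.submodule ≤ linSpan (Set.range x)}

end SecantContact

/-! This is the easy half of Terracini's lemma plus a dimension count. If `q` lies in the span of
`r` points of `X`, the tangent space of `σ_r(X)` at `q` contains the tangent spaces of `X` at those
points (`tangentSpace_le_tangentSpace_secantVariety`). So it contains both `⟨2A⟩` and `T_pX` for
every `p ∈ B`. The affine cone over `σ_r(X)` has dimension at most `r (dim X + 1)`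
(`projDim_secantVariety_add_one_le`). Since `A` is not in the Terracini locus and `r (dim X + 1) ≤ N
+ 1`, the space `⟨2A⟩` has at least this dimension. At the smooth point `q` it is therefore the
whole tangent space, so `T_pX ⊆ ⟨2A⟩`. -/

/-! ### Krull dimension, Noether normalization and transcendence degree -/

/-- Integral injective extensions preserve the Krull dimension. -/
theorem ringKrullDim_eq_of_isIntegral_of_faithfulSMul (R S : Type*) [CommRing R] [CommRing S]
    [Algebra R S] [Algebra.IsIntegral R S] [FaithfulSMul R S] :
    ringKrullDim S = ringKrullDim R := by
  apply le_antisymm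
  · refine Order.krullDim_le_of_strictMono (PrimeSpectrum.comap (algebraMap R S)) ?_
    intro P Q h
    exact Ideal.IsIntegral.comap_lt_comap (A := S) (R := R) (I := P.asIdeal) (J := Q.asIdeal) h
  · refine iSup_le fun l => ?_
    obtain ⟨P, hP, hPl⟩ : (Ideal.primesOver (RelSeries.head l).asIdeal S).Nonempty :=
      Set.nonempty_coe_sort.mp inferInstance
    obtain ⟨L, hL, -⟩ := Ideal.exists_ltSeries_of_hasGoingUp (S := S) l P
    rw [← hL]
    exact Order.LTSeries.length_le_krullDim L

/-- Noether normalization together with the value of the Krull dimension. -/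
theorem exists_isIntegral_inj_algHom_ringKrullDim (k R : Type*) [Field k] [CommRing R]
    [Nontrivial R] [Algebra k R] [Algebra.FiniteType k R] :
    ∃ s : ℕ, ringKrullDim R = s ∧ ∃ g : MvPolynomial (Fin s) k →ₐ[k] R,
      Function.Injective g ∧ g.IsIntegral := by
  obtain ⟨s, g, hg, hi⟩ := exists_integral_inj_algHom_of_fg k R
  refine ⟨s, ?_, g, hg, hi⟩
  algebraize [g.toRingHom]
  have : FaithfulSMul (MvPolynomial (Fin s) k) R :=
    (faithfulSMul_iff_algebraMap_injective _ _).mpr hg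
  have : Algebra.IsIntegral (MvPolynomial (Fin s) k) R := ⟨hi⟩
  rw [ringKrullDim_eq_of_isIntegral_of_faithfulSMul (MvPolynomial (Fin s) k) R]
  simp

universe u

/-- A polynomial ring all of whose elements are integral over the image of a second one has at most
as many variables, even inside a ring with zero divisors. -/
theorem le_of_forall_isIntegralElem {k F : Type u} [Field k] [CommRing F] [Algebra k F] {s m : ℕ}
    (f : MvPolynomial (Fin s) k →ₐ[k] F) (hf : Function.Injective f)
    (G : MvPolynomial (Fin m) k →ₐ[k] F) (h : ∀ x, (G : MvPolynomial (Fin m) k →+* F).IsIntegralElem (f x)) :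
    s ≤ m := by
  -- Transcendence degrees are compared in a domain: the zero ideal of the source is its minimal
  -- prime, so some prime of `F` contracts to it and `f` stays injective modulo that prime.
  obtain ⟨P, hP, hPf⟩ : ∃ P : Ideal F, P.IsPrime ∧ P.comap (f : MvPolynomial (Fin s) k →+* F) = ⊥ := by
    obtain ⟨P, hP, -, h⟩ := Ideal.exists_comap_eq_of_mem_minimalPrimes (I := (⊥ : Ideal F))
      (f : MvPolynomial (Fin s) k →+* F) ⊥ (by
        have : Ideal.comap (f : MvPolynomial (Fin s) k →+* F) ⊥ = ⊥ := by
          rw [← RingHom.ker_eq_comap_bot]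
          exact (RingHom.injective_iff_ker_eq_bot _).mp hf
        rw [this]
        change ⊥ ∈ minimalPrimes _
        rw [IsDomain.minimalPrimes_eq_singleton_bot]
        exact Set.mem_singleton _)
    exact ⟨P, hP, h⟩
  let π : F →ₐ[k] F ⧸ P := Ideal.Quotient.mkₐ k P
  let B : Subalgebra k (F ⧸ P) := (π.comp G).range
  let A := integralClosure B (F ⧸ P)
  have hmem : ∀ x, π (f x) ∈ A := by
    intro x
    obtain ⟨p, hp, hpx⟩ := h x
    refine ⟨p.map ((π.comp G).rangeRestrict : MvPolynomial (Fin m) k →+* B), hp.map _, ?_⟩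
    rw [Polynomial.eval₂_map]
    have := congrArg π hpx
    rw [map_zero] at this
    rw [← this]
    exact (Polynomial.hom_eval₂ p (G : MvPolynomial (Fin m) k →+* F) (π : F →+* F ⧸ P) (f x)).symm
  let φ : MvPolynomial (Fin s) k →ₐ[k] A := (π.comp f).codRestrict (A.restrictScalars k) hmem
  have hφ : Function.Injective φ := by
    rw [injective_iff_map_eq_zero]
    intro x hx
    have h1 : π (f x) = 0 := congrArg Subtype.val hx
    have h2 : x ∈ P.comap (f : MvPolynomial (Fin s) k →+* F) :=
      (Ideal.Quotient.eq_zero_iff_mem (I := P)).mp h1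
    rwa [hPf] at h2
  have h1 := trdeg_le_of_injective φ hφ
  have h2 := trdeg_le_of_surjective (π.comp G).rangeRestrict
    (π.comp G).rangeRestrict_surjective
  have : FaithfulSMul k B := (faithfulSMul_iff_algebraMap_injective k B).mpr
    (algebraMap k B).injective
  have : FaithfulSMul B A := (faithfulSMul_iff_algebraMap_injective B A).mpr fun x y h =>
    Subtype.ext (congrArg (fun a : A => (a : F ⧸ P)) h :)
  have h3 : Algebra.trdeg k B + Algebra.trdeg B A = Algebra.trdeg k A := trdeg_add_eq k B
  have : Algebra.IsIntegral B A := integralClosure.AlgebraIsIntegral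
  have : Algebra.IsAlgebraic B A := Algebra.IsIntegral.isAlgebraic
  have h4 : Algebra.trdeg B A = 0 := trdeg_eq_zero
  rw [MvPolynomial.trdeg_of_isDomain] at h1 h2
  rw [h4, add_zero] at h3
  have h5 := (h1.trans h3.ge).trans h2
  simpa using h5

/-! ### Polynomials on lines and their homogeneous components -/

namespace MvPolynomial

/-- The restriction of a polynomial to the line `t ↦ a + t b`. -/
noncomputable def restrictLine {σ R : Type*} [CommRing R] (f : MvPolynomial σ R) (a b : σ → R) :
    Polynomial R :=
  aeval (fun k => Polynomial.C (a k) + Polynomial.X * Polynomial.C (b k)) f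

theorem eval_restrictLine {σ R : Type*} [CommRing R] (f : MvPolynomial σ R) (a b : σ → R) (t : R) :
    (f.restrictLine a b).eval t = eval (a + t • b) f := by
  induction f using MvPolynomial.induction_on with
  | C c => simp [restrictLine]
  | add p q hp hq => simp_all [restrictLine]
  | mul_X p k hp => simp_all [restrictLine, mul_comm (b k)]

theorem eval_zero_derivative_restrictLine {σ R : Type*} [Fintype σ] [CommRing R]
    (f : MvPolynomial σ R) (a b : σ → R) :
    (f.restrictLine a b).derivative.eval 0 = ∑ k, eval a (pderiv k f) * b k := by
  classical
  induction f using MvPolynomial.induction_on with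
  | C c => simp [restrictLine]
  | add p q hp hq =>
    simp only [restrictLine, map_add, Polynomial.eval_add, add_mul, Finset.sum_add_distrib] at *
    rw [hp, hq]
  | mul_X p j hp =>
    have h0 := eval_restrictLine p a b 0
    simp only [restrictLine, zero_smul, add_zero] at *
    simp only [map_mul, Polynomial.derivative_mul, Polynomial.eval_add, Polynomial.eval_mul, hp,
      h0, aeval_X, pderiv_mul, add_mul, map_add, Finset.sum_add_distrib, pderiv_X, Finset.sum_mul]
    simp [Pi.single_apply, mul_right_comm]

theorem IsHomogeneous.eval_smul {σ R : Type*} [Fintype σ] [CommRing R] {f : MvPolynomial σ R}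
    {d : ℕ} (hf : f.IsHomogeneous d) (t : R) (v : σ → R) : eval (t • v) f = t ^ d * eval v f := by
  rw [eval_eq', eval_eq', Finset.mul_sum]
  refine Finset.sum_congr rfl fun m hm => ?_
  have h := hf (mem_support_iff.mp hm)
  rw [Finsupp.weight_apply, Finsupp.sum_fintype _ _ (by simp)] at h
  simp only [Pi.one_apply, smul_eq_mul, mul_one] at h
  simp only [Pi.smul_apply, smul_eq_mul, mul_pow, Finset.prod_mul_distrib, Finset.prod_pow_eq_pow_sum,
    h]
  ring

/-- A polynomial that vanishes on a punctured line vanishes on the whole line. -/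
theorem restrictLine_eq_zero {σ k : Type*} [Field k] [Infinite k] {f : MvPolynomial σ k}
    {a b : σ → k} (h : ∀ t : k, t ≠ 0 → eval (a + t • b) f = 0) : f.restrictLine a b = 0 := by
  refine Polynomial.eq_zero_of_infinite_isRoot _ (Set.Infinite.mono (s := {0}ᶜ) ?_ ?_)
  · intro t ht
    simpa [Polynomial.IsRoot, eval_restrictLine] using h t ht
  · exact (Set.finite_singleton 0).infinite_compl

theorem eval_eq_zero_of_punctured_line {σ k : Type*} [Field k] [Infinite k] {f : MvPolynomial σ k}
    {a : σ → k} (b : σ → k) (h : ∀ t : k, t ≠ 0 → eval (a + t • b) f = 0) : eval a f = 0 := by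
  have := eval_restrictLine f a b 0
  rw [restrictLine_eq_zero h] at this
  simpa using this.symm

/-- If a polynomial vanishes at all nonzero multiples of a vector, so do its homogeneous
components. -/
theorem eval_homogeneousComponent_eq_zero {σ k : Type*} [Fintype σ] [Field k] [Infinite k]
    {f : MvPolynomial σ k} {v : σ → k} (h : ∀ t : k, t ≠ 0 → eval (t • v) f = 0) (d : ℕ) :
    eval v (homogeneousComponent d f) = 0 := by
  -- The values of the components at `v` are the coefficients of the polynomial `t ↦ f (t • v)`,
  -- which has infinitely many roots.
  have key : ∑ i ∈ Finset.range (f.totalDegree + 1),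
      Polynomial.C (eval v (homogeneousComponent i f)) * Polynomial.X ^ i = 0 := by
    refine Polynomial.eq_zero_of_infinite_isRoot _ (Set.Infinite.mono (s := {0}ᶜ) ?_
      (Set.finite_singleton 0).infinite_compl)
    intro t ht
    have h1 := h t ht
    rw [← sum_homogeneousComponent f, map_sum] at h1
    rw [Set.mem_ofPred_eq, Polynomial.IsRoot, Polynomial.eval_finsetSum, ← h1]
    refine Finset.sum_congr rfl fun i _ => ?_
    rw [(homogeneousComponent_isHomogeneous i f).eval_smul]
    rw [Polynomial.eval_mul, Polynomial.eval_C, Polynomial.eval_pow, Polynomial.eval_X, mul_comm]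
  by_cases hd : d < f.totalDegree + 1
  · have := congrArg (fun P => Polynomial.coeff P d) key
    simpa [Polynomial.coeff_C_mul, Polynomial.coeff_X_pow, hd] using this
  · rw [homogeneousComponent_eq_zero _ _ (by omega), map_zero]

end MvPolynomial

/-! ### Affine cones and the ideal of the secant variety -/

namespace SecantContact

open MvPolynomial

variable {N : ℕ} {X : Set (PN N)}

theorem mem_homIdeal {f : Poly N} : f ∈ homIdeal X ↔ ∀ v ∈ cone X, eval v f = 0 := by
  simp [homIdeal, mem_vanishingIdeal_iff, aeval_eq_eval]

theorem rep_mem_cone {p : PN N} (hp : p ∈ X) : p.rep ∈ cone X :=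
  ⟨p.rep_nonzero, by rwa [p.mk_rep]⟩

theorem smul_mem_cone {v : Fin (N + 1) → ℂ} (hv : v ∈ cone X) {t : ℂ} (ht : t ≠ 0) :
    t • v ∈ cone X := by
  obtain ⟨h0, h⟩ := hv
  refine ⟨smul_ne_zero ht h0, ?_⟩
  rwa [(Projectivization.mk_eq_mk_iff' ℂ (t • v) v (smul_ne_zero ht h0) h0).mpr ⟨t, rfl⟩]

theorem rep_mem_of_submodule_le {q : PN N} {W : Submodule ℂ (Fin (N + 1) → ℂ)}
    (h : q.submodule ≤ W) : q.rep ∈ W :=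
  h (by rw [q.submodule_eq]; exact Submodule.mem_span_singleton_self _)

theorem mem_linSpan_of_mem_cone {v : Fin (N + 1) → ℂ} (hv : v ∈ cone X) : v ∈ linSpan X := by
  obtain ⟨h0, h⟩ := hv
  have h1 : v ∈ (Projectivization.mk ℂ v h0).submodule := by
    rw [Projectivization.submodule_mk]
    exact Submodule.mem_span_singleton_self _
  exact (le_iSup₂_of_le (f := fun (p : PN N) (_ : p ∈ X) => p.submodule) _ h le_rfl) h1

theorem linSpan_le {W : Submodule ℂ (Fin (N + 1) → ℂ)} (h : ∀ p ∈ X, p.rep ∈ W) :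
    linSpan X ≤ W := by
  refine iSup₂_le fun p hp => ?_
  rw [p.submodule_eq, Submodule.span_singleton_le_iff_mem]
  exact h p hp

theorem exists_rep_eq_sum {ι : Type*} [Fintype ι] {x : ι → PN N} {q : PN N}
    (h : q.submodule ≤ linSpan (Set.range x)) : ∃ c : ι → ℂ, q.rep = ∑ i, c i • (x i).rep := by
  have h1 : linSpan (Set.range x) ≤ Submodule.span ℂ (Set.range fun i => (x i).rep) := by
    refine linSpan_le ?_
    rintro _ ⟨i, rfl⟩
    exact Submodule.subset_span ⟨i, rfl⟩
  obtain ⟨c, hc⟩ := (Submodule.mem_span_range_iff_exists_fun ℂ).mp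
    (h1 (rep_mem_of_submodule_le h))
  exact ⟨c, hc.symm⟩

/-- The union of the spans of `r` points of `X`, whose closure is the secant variety. -/
def secantUnion (X : Set (PN N)) (r : ℕ) : Set (PN N) :=
  {q | ∃ x : Fin r → PN N, (∀ i, x i ∈ X) ∧ q.submodule ≤ linSpan (Set.range x)}

theorem secantUnion_subset (X : Set (PN N)) (r : ℕ) : secantUnion X r ⊆ secantVariety X r :=
  Set.subset_sInter fun _ hZ => hZ.2

/-- Polynomials that vanish on the secant variety vanish on sums of points of the affine cone. -/
theorem eval_sum_eq_zero {r : ℕ} {f : Poly N} (hf : f ∈ homIdeal (secantVariety X r))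
    (i₀ : Fin r) (c : Fin r → ℂ) {y : Fin r → Fin (N + 1) → ℂ} (hy : ∀ i, y i ∈ cone X) :
    eval (∑ i, c i • y i) f = 0 := by
  rw [mem_homIdeal] at hf
  have key : ∀ c : Fin r → ℂ, ∑ i, c i • y i ≠ 0 → eval (∑ i, c i • y i) f = 0 := by
    intro c hc
    refine hf _ ⟨hc, secantUnion_subset X r
      ⟨fun i => Projectivization.mk ℂ (y i) (hy i).1, fun i => (hy i).2, ?_⟩⟩
    rw [Projectivization.submodule_mk, Submodule.span_singleton_le_iff_mem]
    exact Submodule.sum_mem _ fun i _ => Submodule.smul_mem _ _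
      (mem_linSpan_of_mem_cone ⟨(hy i).1, ⟨i, rfl⟩⟩)
  -- The zero vector is no projective point; it is reached as a limit along the line of `y i₀`.
  by_cases h : ∑ i, c i • y i = 0
  · rw [h]
    refine eval_eq_zero_of_punctured_line (y i₀) fun t ht => ?_
    have h1 : ∑ i, (Pi.single i₀ t : Fin r → ℂ) i • y i = 0 + t • y i₀ := by
      simp [Pi.single_apply, ite_smul]
    rw [← h1]
    refine key _ ?_
    rw [h1, zero_add]
    exact smul_ne_zero ht (hy i₀).1
  · exact key c h

/-- A polynomial that vanishes on sums of `r` points of the affine cone over `X` lies in the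
ideal of the secant variety. -/
theorem mem_homIdeal_secantVariety {r : ℕ} {f : Poly N}
    (h : ∀ y : Fin r → Fin (N + 1) → ℂ, (∀ i, y i ∈ cone X) → eval (∑ i, y i) f = 0) :
    f ∈ homIdeal (secantVariety X r) := by
  have h1 : ∀ (c : Fin r → ℂ) (y : Fin r → Fin (N + 1) → ℂ), (∀ i, y i ∈ cone X) →
      eval (∑ i, c i • y i) f = 0 := by
    intro c y hy
    -- A term with coefficient zero leaves the cone, so it is replaced by `t • y i` with `t ≠ 0`.
    refine eval_eq_zero_of_punctured_line (∑ i, if c i = 0 then y i else 0) fun t ht => ?_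
    rw [Finset.smul_sum, ← Finset.sum_add_distrib]
    refine h _ fun i => ?_
    by_cases hc : c i = 0
    · simpa [hc] using smul_mem_cone (hy i) ht
    · simpa [hc] using smul_mem_cone (hy i) hc
  have h2 : secantVariety X r ⊆ {p | ∀ g ∈ Set.range fun d => homogeneousComponent d f,
      eval p.rep g = 0} := by
    refine Set.sInter_subset_of_mem ⟨⟨_, ?_, rfl⟩, ?_⟩
    · rintro _ ⟨d, rfl⟩
      exact ⟨d, homogeneousComponent_isHomogeneous d f⟩
    · rintro q ⟨x, hx, hq⟩ _ ⟨d, rfl⟩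
      obtain ⟨c, hc⟩ := exists_rep_eq_sum hq
      refine eval_homogeneousComponent_eq_zero (fun t _ => ?_) d
      rw [hc, Finset.smul_sum]
      simp_rw [smul_smul]
      exact h1 _ _ fun i => rep_mem_cone (hx i)
  rw [mem_homIdeal]
  rintro v ⟨hv0, hv⟩
  obtain ⟨a, ha⟩ := Projectivization.exists_smul_eq_mk_rep ℂ v hv0
  rw [← sum_homogeneousComponent f, map_sum]
  refine Finset.sum_eq_zero fun d _ => ?_
  have h3 := h2 hv _ ⟨d, rfl⟩
  rw [← ha, Units.smul_def, (homogeneousComponent_isHomogeneous d f).eval_smul] at h3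
  exact (mul_eq_zero.mp h3).resolve_left (pow_ne_zero _ a.ne_zero)

/-! ### Tangent spaces of the secant variety -/

theorem mem_tangentSpace {p : PN N} {v : Fin (N + 1) → ℂ} :
    v ∈ tangentSpace X p ↔
      ∀ f ∈ homIdeal X, (f.restrictLine p.rep v).derivative.eval 0 = 0 := by
  simp only [eval_zero_derivative_restrictLine]
  rfl

/-- If `q` lies in the span of points `x i` of the nondegenerate variety `X`, then the tangent
space of the secant variety at `q` contains the tangent spaces of `X` at the points `x i`. -/
theorem tangentSpace_le_tangentSpace_secantVariety (hnd : IsNondegenerate X) {r : ℕ}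
    {x : Fin r → PN N} (hx : ∀ i, x i ∈ X) {q : PN N}
    (hq : q.submodule ≤ linSpan (Set.range x)) (i : Fin r) :
    tangentSpace X (x i) ≤ tangentSpace (secantVariety X r) q := by
  obtain ⟨c, hc⟩ := exists_rep_eq_sum hq
  set a := ∑ j ∈ Finset.univ.erase i, c j • (x j).rep
  have hqa : q.rep = a + c i • (x i).rep :=
    hc.trans (Finset.sum_erase_add _ _ (Finset.mem_univ i)).symm
  have key : ∀ f ∈ homIdeal (secantVariety X r), ∀ t : ℂ, ∀ y ∈ cone X,
      eval (a + t • y) f = 0 := by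
    intro f hf t y hy
    have h := eval_sum_eq_zero hf i (Function.update c i t)
      (y := Function.update (fun j => (x j).rep) i y) (by
        intro j
        by_cases hj : j = i
        · subst hj; simpa using hy
        · simpa [hj] using rep_mem_cone (hx j))
    rw [← Finset.sum_erase_add _ _ (Finset.mem_univ i)] at h
    have hsum : ∑ j ∈ Finset.univ.erase i, Function.update c i t j •
        Function.update (fun j => (x j).rep) i y j = a :=
      Finset.sum_congr rfl fun j hj => by
        rw [Function.update_of_ne (Finset.ne_of_mem_erase hj),
          Function.update_of_ne (Finset.ne_of_mem_erase hj)]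
    rwa [hsum, Function.update_self, Function.update_self] at h
  -- If `c i = 0`, the chain rule gives nothing, but every `f` in the ideal vanishes on the lines
  -- from `q` in the directions of `cone X`. These directions span everything by nondegeneracy.
  by_cases hci : c i = 0
  · have hle : linSpan X ≤ tangentSpace (secantVariety X r) q := by
      refine linSpan_le fun p hp => mem_tangentSpace.mpr fun f hf => ?_
      rw [restrictLine_eq_zero]
      · simp
      · intro t _
        rw [hqa, hci, zero_smul, add_zero]
        exact key f hf t _ (rep_mem_cone hp)
    exact le_top.trans (hnd.ge.trans hle)
  · intro v hv
    rw [mem_tangentSpace] at hv ⊢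
    intro f hf
    -- The pullback of `f` along `y ↦ a + c i • y` vanishes on `cone X`; its derivative at `x i`
    -- along `v` is `c i` times that of `f` at `q`.
    let g : Poly N := aeval (fun k => C (a k) + C (c i) * MvPolynomial.X k) f
    have hg : ∀ y, eval y g = eval (a + c i • y) f := by
      intro y
      have h : (aeval y).comp (aeval fun k => C (a k) + C (c i) * MvPolynomial.X k) =
          (aeval (a + c i • y) : Poly N →ₐ[ℂ] ℂ) := by
        ext k; simp
      exact DFunLike.congr_fun h f
    have h1 := hv g (mem_homIdeal.mpr fun y hy => by rw [hg, key f hf _ y hy])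
    have h2 : g.restrictLine (x i).rep v = f.restrictLine q.rep (c i • v) := by
      refine Polynomial.funext fun t => ?_
      rw [eval_restrictLine, eval_restrictLine, hg, hqa, smul_add, add_assoc, smul_comm]
    rw [h2, eval_zero_derivative_restrictLine] at h1
    rw [eval_zero_derivative_restrictLine]
    refine (mul_eq_zero.mp (?_ : c i * _ = 0)).resolve_left hci
    rw [← h1, Finset.mul_sum]
    refine Finset.sum_congr rfl fun k _ => ?_
    rw [Pi.smul_apply, smul_eq_mul]
    ring

/-! ### Dimension bound for the secant variety -/

/-- The dimension of the affine cone over the secant variety is at most `r (dim X + 1)`. -/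
theorem projDim_secantVariety_add_one_le (hX : IsIntegralVariety X) {r : ℕ} (hr : 0 < r) :
    projDim (secantVariety X r) + 1 ≤ r * (projDim X + 1) := by
  have hprime := hX.prime
  have hne : (cone X).Nonempty := by
    by_contra h
    rw [Set.not_nonempty_iff_eq_empty] at h
    exact hprime.ne_top (by rw [homIdeal, h, vanishingIdeal_empty])
  have : Nonempty (cone X) := hne.to_subtype
  -- With all functions on the product of cones, possibly with zero divisors, irreducibility of the
  -- product is not needed.
  let F := (Fin r → cone X) → ℂ
  let φ : Poly N →ₐ[ℂ] F := aeval fun k y => ∑ i, (y i : Fin (N + 1) → ℂ) k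
  have hφ : ∀ f y, φ f y = eval (∑ i, (y i : Fin (N + 1) → ℂ)) f := by
    intro f y
    have : (Pi.evalAlgHom ℂ (fun _ => ℂ) y).comp φ = aeval (∑ i, (y i : Fin (N + 1) → ℂ)) := by
      ext k; simp [φ]
    exact DFunLike.congr_fun this f
  have hker : RingHom.ker φ = homIdeal (secantVariety X r) := by
    ext f
    rw [RingHom.mem_ker]
    constructor
    · intro h
      refine mem_homIdeal_secantVariety fun y hy => ?_
      rw [← hφ f fun i => ⟨y i, hy i⟩, h]
      rfl
    · intro h
      funext y
      refine (hφ f y).trans ?_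
      change _ = (0 : ℂ)
      simpa using eval_sum_eq_zero h ⟨0, hr⟩ (fun _ => 1) fun i => (y i).2
  let ψ : (Poly N ⧸ homIdeal (secantVariety X r)) →ₐ[ℂ] F :=
    Ideal.Quotient.liftₐ _ φ fun f hf => by rwa [← hker] at hf
  have hψ : Function.Injective ψ := by
    rw [injective_iff_map_eq_zero]
    intro z
    obtain ⟨f, rfl⟩ := Ideal.Quotient.mk_surjective z
    intro hz
    rw [Ideal.Quotient.eq_zero_iff_mem, ← hker]
    exact hz
  have := ψ.toRingHom.domain_nontrivial
  let π (i : Fin r) : (Poly N ⧸ homIdeal X) →ₐ[ℂ] F :=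
    Ideal.Quotient.liftₐ _ (aeval fun k y => (y i : Fin (N + 1) → ℂ) k) fun f hf => by
      funext y
      have : (Pi.evalAlgHom ℂ (fun _ => ℂ) y).comp
          (aeval fun k (y : Fin r → cone X) => (y i : Fin (N + 1) → ℂ) k) =
            aeval (y i : Fin (N + 1) → ℂ) := by
        ext k; simp
      exact (DFunLike.congr_fun this f).trans (hf _ (y i).2)
  obtain ⟨s, hs, f, hf, -⟩ := exists_isIntegral_inj_algHom_ringKrullDim ℂ
    (Poly N ⧸ homIdeal (secantVariety X r))
  have : Nontrivial (Poly N ⧸ homIdeal X) := Ideal.Quotient.nontrivial_iff.mpr hprime.ne_top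
  obtain ⟨d, hd, g, -, hg⟩ := exists_isIntegral_inj_algHom_ringKrullDim ℂ (Poly N ⧸ homIdeal X)
  -- One copy of the `d` Noether variables of `X` for each of the `r` factors.
  let G : MvPolynomial (Fin (r * d)) ℂ →ₐ[ℂ] F :=
    aeval fun m => π (finProdFinEquiv.symm m).1 (g (MvPolynomial.X (finProdFinEquiv.symm m).2))
  have hG : ∀ i z, (G : MvPolynomial (Fin (r * d)) ℂ →+* F).IsIntegralElem (π i z) := by
    intro i z
    have h1 : (π i).comp g = G.comp (rename fun j => finProdFinEquiv (i, j)) := by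
      ext1 j
      simp only [AlgHom.comp_apply, rename_X, G, aeval_X, Equiv.symm_apply_apply]
    obtain ⟨p, hp, hpz⟩ := hg z
    refine ⟨p.map (rename fun j => finProdFinEquiv (i, j) :
      MvPolynomial (Fin d) ℂ →ₐ[ℂ] MvPolynomial (Fin (r * d)) ℂ).toRingHom, hp.map _, ?_⟩
    rw [Polynomial.eval₂_map]
    have h2 := congrArg (π i) hpz
    rw [map_zero] at h2
    rw [← h2]
    refine Eq.trans ?_ (Polynomial.hom_eval₂ p g.toRingHom (π i).toRingHom z).symm
    congr 1
    exact (congrArg AlgHom.toRingHom h1).symm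
  have hle : s ≤ r * d := by
    refine le_of_forall_isIntegralElem (ψ.comp f) (hψ.comp hf) G fun x => ?_
    obtain ⟨p, hp⟩ := Ideal.Quotient.mk_surjective (f x)
    have h1 : (ψ.comp f) x = φ p := by
      rw [AlgHom.comp_apply, ← hp]
      rfl
    rw [h1]
    clear h1 hp
    induction p using MvPolynomial.induction_on with
    | C c =>
      have : φ (C c) = G (C c) := by simp [φ, G]
      rw [this]
      exact (G : MvPolynomial (Fin (r * d)) ℂ →+* F).isIntegralElem_map
    | add p q hp hq => rw [map_add]; exact hp.add _ hq
    | mul_X p k hp =>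
      rw [map_mul]
      refine hp.mul _ ?_
      have : φ (MvPolynomial.X k) = ∑ i, π i (Ideal.Quotient.mk _ (MvPolynomial.X k)) := by
        funext y
        refine (hφ _ y).trans ?_
        rw [eval_X, Finset.sum_apply, Finset.sum_apply]
        refine Finset.sum_congr rfl fun i _ => ?_
        exact (congrFun (aeval_X (R := ℂ)
          (fun k (y : Fin r → cone X) => (y i : Fin (N + 1) → ℂ) k) k) y).symm
      rw [this]
      exact Finset.sum_induction _ (G : MvPolynomial (Fin (r * d)) ℂ →+* F).IsIntegralElem
        (fun _ _ h h' => h.add _ h') (RingHom.isIntegralElem_zero _) fun i _ => hG i _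
  have hs' : projDim (secantVariety X r) = s - 1 := by
    rw [projDim, hs]; rfl
  have hd' : projDim X = d - 1 := by
    rw [projDim, hd]; rfl
  have h1 : r * d ≤ r * (projDim X + 1) := Nat.mul_le_mul_left r (by omega)
  -- This covers `s = 0`, where the truncated `s - 1` gives `projDim + 1 = 1`.
  have h2 : 1 ≤ r * (projDim X + 1) := Nat.mul_pos hr (Nat.succ_pos _)
  omega

end SecantContact

/-! ### The contact locus theorem -/

theorem mainTheorem9 (N r : ℕ) (X : Set (SecantContact.PN N))
    (hX : SecantContact.IsIntegralVariety X)
    (hnd : SecantContact.IsNondegenerate X)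
    (hr : (r : ℚ) ≤ ((N : ℚ) + 1) / ((SecantContact.projDim X : ℚ) + 1) - 1)
    (A : Finset (SecantContact.PN N))
    (hA : A ∈ SecantContact.smoothSets X r)
    (hAT : A ∉ SecantContact.terraciniLocus X r)
    (q : SecantContact.PN N)
    (hq : q.submodule ≤ SecantContact.linSpan (A : Set (SecantContact.PN N)))
    (hqs : q ∉ SecantContact.singLocus (SecantContact.secantVariety X r))
    (B : Finset (SecantContact.PN N))
    (hB : B ∈ SecantContact.smoothSets X r)
    (hBA : B ≠ A)
    (hqB : q.submodule ≤ SecantContact.linSpan (B : Set (SecantContact.PN N))) :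
    (B : Set (SecantContact.PN N)) ⊆
      (A : Set (SecantContact.PN N)) ∪ SecantContact.extraContact X A := by
  open SecantContact in
  have henum : ∀ D ∈ smoothSets X r, ∃ x : Fin r → PN N, Set.range x = D ∧ ∀ i, x i ∈ X := by
    rintro D ⟨hcard, hD⟩
    let e := (D.equivFinOfCardEq hcard).symm
    refine ⟨fun i => e i, ?_, fun i => (hD (e i).2).1⟩
    ext p
    exact ⟨by rintro ⟨i, rfl⟩; exact (e i).2, fun hp => ⟨e.symm ⟨p, hp⟩, by simp⟩⟩
  have htan : ∀ D ∈ smoothSets X r, q.submodule ≤ linSpan (D : Set (PN N)) →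
      ∀ p ∈ D, tangentSpace X p ≤ tangentSpace (secantVariety X r) q := by
    intro D hD hqD p hp
    obtain ⟨x, hxD, hx⟩ := henum D hD
    rw [← hxD] at hqD
    obtain ⟨i, rfl⟩ : p ∈ Set.range x := by rw [hxD]; exact hp
    exact tangentSpace_le_tangentSpace_secantVariety hnd hx hqD i
  intro p hp
  have hr0 : 0 < r := by
    rw [← hB.1]
    exact Finset.card_pos.mpr ⟨p, hp⟩
  have hqσ : q ∈ secantVariety X r := by
    obtain ⟨x, hxA, hx⟩ := henum A hA
    rw [← hxA] at hq
    exact secantUnion_subset X r ⟨x, hx, hq⟩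
  have hqreg : q ∈ regLocus (secantVariety X r) := by
    by_contra h
    exact hqs ⟨hqσ, h⟩
  have hrN : r * (projDim X + 1) ≤ N + 1 := by
    have h0 : (0 : ℚ) < (projDim X : ℚ) + 1 := by positivity
    have h1 : (r : ℚ) ≤ ((N : ℚ) + 1) / ((projDim X : ℚ) + 1) := hr.trans (by linarith)
    rw [le_div_iff₀ h0] at h1
    exact_mod_cast h1
  have hle : doubleSpan X A ≤ tangentSpace (secantVariety X r) q :=
    iSup₂_le fun a ha => htan A hA hq a ha
  -- A smaller rank would put `A` in the Terracini locus: `⟨2A⟩ = ⊤` is excluded, as its rank `N +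
  -- 1` is at least `r (dim X + 1)`.
  have hrank : r * (projDim X + 1) ≤ Module.finrank ℂ (doubleSpan X A) := by
    by_contra! h
    refine hAT ⟨hA, fun htop => ?_, h⟩
    rw [htop, finrank_top, Module.finrank_fin_fun] at h
    omega
  have heq : doubleSpan X A = tangentSpace (secantVariety X r) q := by
    refine Submodule.eq_of_le_of_finrank_le hle ?_
    rw [hqreg.2]
    exact (projDim_secantVariety_add_one_le hX hr0).trans hrank
  by_cases hpA : p ∈ A
  · exact Or.inl hpA
  · exact Or.inr ⟨⟨hB.2 hp, heq ▸ htan B hB hqB p hp⟩, hpA⟩
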